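/- Let $n\ge 0$ be an integer, let $\zeta=\zeta_{2^{n+1}}\in\mathbb{C}$ be a primitive $2^{n+1}$-th root of unity, and let $\mathcal{I}=\mathfrak{p}_1\mathfrak{p}_2\cdots\mathfrak{p}_t$ ($t\ge 0$) be a nonzero ideal of $\mathbb{Z}[\zeta]$, written as a product of nonzero, not necessarily distinct prime ideals. Let $p_i$ be the rational prime contained in $\mathfrak{p}_i$. Write $p_i=2^{A_i}m_i+1$ if $p_i\equiv 1\pmod 4$ and $p_i=2^{A_i}m_i-1$ if $p_i\equiv 3\pmod 4$, with $m_i$ odd, and put $$r_i=\begin{cases}\min\{A_i-1,n\}, & p_i\equiv 1\pmod 4,\\ \min\{A_i,n\}, & p_i\equiv 3\pmod 4,\\ n, & p_i=2,\end{cases}\qquad r=\max_i r_i$$ (with $r=0$ if $t=0$). Let $\eta=\zeta^{2^{n-r}}$, $K=\mathbb{Q}(\eta)$ with ring of integers $O_K$, and $\mathfrak{c}=\mathcal{I}\cap O_K$. Use the coefficient embeddings $\mathbb{Q}(\zeta)\to\mathbb{R}^{2^n}$, $\sum_{i<2^n}a_i\zeta^i\mapsto(a_0,\dots,a_{2^n-1})$,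 and $K\to\mathbb{R}^{2^r}$, $\sum_{j<2^r}a_j\eta^j\mapsto(a_0,\dots,a_{2^r-1})$, with Euclidean norms; let $\mathcal{L}\subset\mathbb{R}^{2^n}$ and $\mathcal{L}'\subset\mathbb{R}^{2^r}$ be the images of $\mathcal{I}$ and $\mathfrak{c}$, and let $\lambda_1$ denote the length of a shortest nonzero vector. Then the shortest vector problem (SVP) in $\mathcal{L}$ reduces to SVP in the $2^r$-dimensional lattice $\mathcal{L}'$, in the following sense. 1. $\mathcal{I}=\bigoplus_{k=0}^{2^{n-r}-1}\zeta^k\mathfrak{c}$ is a direct sum of abelian groups, and the summands are pairwise orthogonal under the coefficient embedding of $\mathbb{Q}(\zeta)$. 2. $\mathcal{L}'$ is a lattice of full rank $2^r$ in $\mathbb{R}^{2^r}$, and $\lambda_1(\mathcal{L})=\lambda_1(\mathcal{L}')$. 3. If $x\in K$ is mapped to a shortest nonzero vector of $\mathcal{L}'$, then the $2^{n-r}$ elements $\zeta^k x$ ($0\le k<2^{n-r}$) are distinct, and each is mapped to a shortest nonzero vector of $\mathcal{L}$. 4. Let $B\in\mathbb{Z}^{2^n\times 2^n}$ be a lower triangular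 matrix whose rows generate $\mathcal{L}$ (for instance a Hermite normal form), with rows and columns indexed from $0$, and let $B'\in\mathbb{Z}^{2^r\times 2^r}$ be the submatrix of the entries whose row and column indices are both multiples of $2^{n-r}$. Then $B'$ is nonsingular and its rows generate $\mathcal{L}'$. Consequently, for any oracle that, given a nonsingular matrix in $\mathbb{Z}^{2^r\times 2^r}$, returns a shortest nonzero vector of the lattice generated by its rows, if $w$ is its answer on $B'$, then the vector of $\mathbb{Z}^{2^n}$ with entry $w_j$ at position $2^{n-r}j$ for $0\le j<2^r$ and zeros elsewhere is a shortest nonzero vector of $\mathcal{L}$. -/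

import Mathlib

open scoped IntermediateField

namespace IdealSVP

noncomputable section

/-! ### The coefficient embedding -/

theorem natDegree_minpoly {s : ℕ} {α : ℂ} (hα : IsPrimitiveRoot α (2 ^ (s + 1))) :
    (minpoly ℚ α).natDegree = 2 ^ s := by
  have h0 : 0 < 2 ^ (s + 1) := by positivity
  rw [← Polynomial.cyclotomic_eq_minpoly_rat hα h0, Polynomial.natDegree_cyclotomic,
    Nat.totient_prime_pow_succ Nat.prime_two]
  simp

/-- The `ℚ`-basis `1, α, α², …, α ^ (2 ^ s - 1)` of `ℚ(α)`, for a complex primitive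
`2 ^ (s + 1)`-th root of unity `α`. -/
def powerBasis {s : ℕ} {α : ℂ} (hα : IsPrimitiveRoot α (2 ^ (s + 1))) :
    Module.Basis (Fin (2 ^ s)) ℚ ℚ⟮α⟯ :=
  (IntermediateField.adjoin.powerBasis
    ((hα.isIntegral (by positivity)).tower_top (A := ℚ))).basis.reindex
      (finCongr (by
        rw [IntermediateField.adjoin.powerBasis_dim]
        exact natDegree_minpoly hα))

theorem powerBasis_apply {s : ℕ} {α : ℂ} (hα : IsPrimitiveRoot α (2 ^ (s + 1)))
    (i : Fin (2 ^ s)) : ((powerBasis hα i : ℚ⟮α⟯) : ℂ) = α ^ (i : ℕ) := by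
  simp [powerBasis]

/-- The coefficient embedding `ℚ(α) → ℝ ^ (2 ^ s)`,
`a₀ + a₁ α + … + a_{N-1} α ^ (N-1) ↦ (a₀, …, a_{N-1})` with `N = 2 ^ s`. -/
def coeffEmbedding {s : ℕ} {α : ℂ} (hα : IsPrimitiveRoot α (2 ^ (s + 1))) :
    ℚ⟮α⟯ →ₗ[ℤ] EuclideanSpace ℝ (Fin (2 ^ s)) where
  toFun x := WithLp.toLp 2 fun i => (((powerBasis hα).repr x i : ℚ) : ℝ)
  map_add' x y := by ext i; simp
  map_smul' c x := by
    have h : (powerBasis hα).repr (c • x) = c • (powerBasis hα).repr x := map_zsmul _ c x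
    ext i
    simp only [h]
    simp

/-- The inclusion `K ⊆ ℂ` as a `ℤ`-linear map. -/
def inclusion (K : IntermediateField ℚ ℂ) : K →ₗ[ℤ] ℂ :=
  K.val.toLinearMap.restrictScalars ℤ

/-- The image under the coefficient embedding of `ℚ(α)` of the elements of `S` (here always a
`ℤ`-submodule of `ℚ(α)`). -/
def coeffLattice {s : ℕ} {α : ℂ} (hα : IsPrimitiveRoot α (2 ^ (s + 1))) (S : Submodule ℤ ℂ) :
    Submodule ℤ (EuclideanSpace ℝ (Fin (2 ^ s))) :=
  (S.comap (inclusion ℚ⟮α⟯)).map (coeffEmbedding hα)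

/-! ### Ideals of `ℤ[ζ]` and their intersection with a subfield -/

/-- The ring `ℤ[ζ]`. -/
abbrev IntAdjoin (ζ : ℂ) : Subalgebra ℤ ℂ := Algebra.adjoin ℤ {ζ}

/-- An ideal of `ℤ[ζ]`, as an additive group of complex numbers. -/
def idealModule {ζ : ℂ} (I : Ideal (IntAdjoin ζ)) : Submodule ℤ ℂ :=
  (I.restrictScalars ℤ).map (IntAdjoin ζ).val.toLinearMap

/-- The ring of integers `O_K` of `K`, as an additive group of complex numbers. -/
def integersModule (K : IntermediateField ℚ ℂ) : Submodule ℤ ℂ :=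
  (Subalgebra.toSubmodule (integralClosure ℤ K)).map (inclusion K)

/-- The intersection `I ∩ O_K`. -/
def interIntegers {ζ : ℂ} (I : Ideal (IntAdjoin ζ)) (K : IntermediateField ℚ ℂ) :
    Submodule ℤ ℂ :=
  idealModule I ⊓ integersModule K

/-- The translate `ζ ^ k S = {ζ ^ k x : x ∈ S}`. -/
def mulPow (ζ : ℂ) (k : ℕ) (S : Submodule ℤ ℂ) : Submodule ℤ ℂ :=
  S.map (LinearMap.mulLeft ℤ (ζ ^ k))

/-! ### The exponents `r_i` and `r` -/

/-- The exponent attached to a prime `p = 2 ^ A * m ± 1`; the last case is `p = 2`. -/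
def primeExp (n p A : ℕ) : ℕ :=
  if p % 4 = 1 then min (A - 1) n else if p % 4 = 3 then min A n else n

/-- The maximum of the exponents (`0` for an empty family). -/
def maxExp (n : ℕ) {t : ℕ} (p A : Fin t → ℕ) : ℕ :=
  Finset.univ.sup fun i => primeExp n (p i) (A i)

theorem maxExp_le (n : ℕ) {t : ℕ} (p A : Fin t → ℕ) : maxExp n p A ≤ n := by
  refine Finset.sup_le fun i _ => ?_
  unfold primeExp
  split_ifs <;> simp

/-- If `ζ` is a primitive `2 ^ (n + 1)`-th root of unity, then `ζ ^ (2 ^ (n - r))` is a primitive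
`2 ^ (r + 1)`-th root of unity. -/
theorem isPrimitiveRoot_pow {n r : ℕ} {ζ : ℂ} (hζ : IsPrimitiveRoot ζ (2 ^ (n + 1)))
    (hr : r ≤ n) : IsPrimitiveRoot (ζ ^ 2 ^ (n - r)) (2 ^ (r + 1)) := by
  refine hζ.pow (by positivity) ?_
  rw [← pow_add]
  congr 1
  omega

/-! ### Lattices and the shortest vector problem -/

/-- `v` is a shortest nonzero vector of `Λ`. -/
def IsShortest {d : ℕ} (Λ : Submodule ℤ (EuclideanSpace ℝ (Fin d)))
    (v : EuclideanSpace ℝ (Fin d)) : Prop :=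
  v ∈ Λ ∧ v ≠ 0 ∧ ∀ w ∈ Λ, w ≠ 0 → ‖v‖ ≤ ‖w‖

/-- The first minimum `λ₁(Λ)`. -/
def firstMin {d : ℕ} (Λ : Submodule ℤ (EuclideanSpace ℝ (Fin d))) : ℝ :=
  sInf {x : ℝ | ∃ v ∈ Λ, v ≠ 0 ∧ ‖v‖ = x}

/-- An integer vector as a vector of Euclidean space. -/
def intVec {d : ℕ} (v : Fin d → ℤ) : EuclideanSpace ℝ (Fin d) :=
  WithLp.toLp 2 fun i => (v i : ℝ)

/-- The lattice generated by the rows of an integer matrix. -/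
def rowLattice {d : ℕ} (B : Matrix (Fin d) (Fin d) ℤ) :
    Submodule ℤ (EuclideanSpace ℝ (Fin d)) :=
  Submodule.span ℤ (Set.range fun i => intVec (B i))

/-- An SVP oracle in dimension `d`: given a nonsingular integer matrix, it returns a shortest
nonzero vector of the lattice generated by the rows. -/
def IsSVPOracle {d : ℕ} (solve : Matrix (Fin d) (Fin d) ℤ → (Fin d → ℤ)) : Prop :=
  ∀ B, B.det ≠ 0 → IsShortest (rowLattice B) (intVec (solve B))

/-- The index `2 ^ (n - r) * j` (which is less than `2 ^ n` when `r ≤ n`). -/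
def spreadIndex (n r : ℕ) (j : Fin (2 ^ r)) : Fin (2 ^ n) :=
  Fin.ofNat (2 ^ n) (2 ^ (n - r) * j)

/-- The integer vector of length `2 ^ n` with `w j` at position `2 ^ (n - r) * j` for each `j`,
and zeros elsewhere. -/
def zeroPad (n r : ℕ) (w : Fin (2 ^ r) → ℤ) : Fin (2 ^ n) → ℤ :=
  fun i => ∑ j : Fin (2 ^ r), if spreadIndex n r j = i then w j else 0

end

end IdealSVP

open IdealSVP

namespace IdealSVP

/-! ### Powers of an odd prime modulo powers of two -/

/-! The arithmetic core is that each prime `P` over `p` is generated by its elements in a smaller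
order `ℤ[ζ ^ 2 ^ k]`, shown by descent from `ℤ[b]` to `ℤ[b²]`, with `b` a 2-power power of `ζ`.
Write `x ∈ P ∩ ℤ[b]` as `u + b v` with `u, v ∈ ℤ[b²]`. If `b` has order `2 ^ (e + 2)` and some `p ^
f` is `1` modulo `2 ^ (e + 1)` but not modulo `2 ^ (e + 2)`, then the `f`-th Frobenius power on the
domain `ℤ[ζ] ⧸ P` negates `b` and fixes the image of `ℤ[b²]`. Hence `u - b v` vanishes there with `u
+ b v`, and since `2` and `b` are nonzero, `u, v ∈ P`. Such an `f` exists exactly as far down as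
`primeExp` is used (`exists_pow_eq_of_primeExp`, `GeneratedAt.of_isPrime`).

Generation in a given order passes to products, so `I` is generated by `I ∩ ℤ[η] = 𝔠`, and therefore
`I = ∑ ζ ^ k 𝔠` (`iSup_mulPow_eq_idealModule`). Since `ζ ^ k η ^ j = ζ ^ (k + 2 ^ (n - r) j)`, the
summands occupy disjoint sets of coordinates: a vector lies in `Λ` iff each of its residue-class
components lies in `Λ'` (`mem_coeffLattice_iSup_mulPow`). Orthogonality and all statements on
shortest vectors follow from this criterion; for triangular bases it is combined with back
substitution (`rowLattice_submatrix`). -/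

theorem exists_pow_two_pow_eq {Q a u : ℕ} (ha : 1 ≤ a) (hu : Odd u)
    (hQ : Q = 2 ^ (a + 1) * u + 1) (k : ℕ) :
    ∃ v, Odd v ∧ Q ^ 2 ^ k = 2 ^ (a + 1 + k) * v + 1 := by
  induction k with
  | zero => exact ⟨u, hu, by simp [hQ]⟩
  | succ k ih =>
    obtain ⟨v, hv, h⟩ := ih
    -- From `(2 ^ e v + 1)² = 2 ^ (e + 1) v (2 ^ (e - 1) v + 1) + 1` with `e = a + 1 + k`. The new
    -- cofactor is odd because `e ≥ 2`, which is where `1 ≤ a` enters.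
    refine ⟨v * (2 ^ (a + k) * v + 1), hv.mul (Even.add_one ?_), ?_⟩
    · exact ((even_two.pow_of_ne_zero (by omega)).mul_right v)
    · rw [pow_succ, pow_mul, h]
      ring

/-- For `p = 2 ^ A * m ± 1` and `s` at least the exponent attached to `p`, some power of `p` is
congruent to `1` modulo `2 ^ (s + 1)` but not modulo `2 ^ (s + 2)`. -/
theorem exists_pow_eq_of_primeExp {n p A m s : ℕ} (hm : Odd m)
    (hA1 : p % 4 = 1 → p = 2 ^ A * m + 1) (hA3 : p % 4 = 3 → p + 1 = 2 ^ A * m)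
    (hs : primeExp n p A ≤ s) (hsn : s < n) :
    p ≠ 2 ∧ ∃ f v, Odd v ∧ p ^ f = 2 ^ (s + 1) * v + 1 := by
  have two_le : 4 ∣ 2 ^ A * m → 2 ≤ A := by
    intro h
    have h4 : 2 ^ 2 ∣ 2 ^ A :=
      ((Nat.Coprime.pow_left 2 (Nat.coprime_two_left.2 hm)).dvd_of_dvd_mul_right
        (by simpa using h))
    exact (Nat.pow_dvd_pow_iff_le_right (by norm_num)).1 h4
  unfold primeExp at hs
  split_ifs at hs with h1 h3
  · have hpe := hA1 h1
    have hA : 2 ≤ A := two_le (by omega)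
    obtain ⟨v, hv, h⟩ := exists_pow_two_pow_eq (Q := p) (a := A - 1) (by omega) hm
      (by rwa [show A - 1 + 1 = A by omega]) (s + 1 - A)
    refine ⟨by omega, 2 ^ (s + 1 - A), v, hv, ?_⟩
    rw [h]
    congr 3
    omega
  · have hpe := hA3 h3
    have hA : 2 ≤ A := two_le (by omega)
    obtain ⟨c, hc⟩ : ∃ c, p = 4 * c + 3 := ⟨p / 4, by omega⟩
    -- Here `p ≡ -1` modulo `2 ^ A`, so one squares first: `p² - 1 = (p + 1)(p - 1)` with `p - 1 = 2
    -- (2 c + 1)` gains one factor `2`. Hence the exponent is `A` here and `A - 1` for `p ≡ 1`.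
    obtain ⟨v, hv, h⟩ := exists_pow_two_pow_eq (Q := p ^ 2) (a := A) (u := m * (2 * c + 1))
      (by omega) (hm.mul ⟨c, rfl⟩)
      (by
        have : p ^ 2 = (p + 1) * (2 * (2 * c + 1)) + 1 := by rw [hc]; ring
        rw [this, hpe]
        ring) (s - A)
    refine ⟨by omega, 2 * 2 ^ (s - A), v, hv, ?_⟩
    rw [pow_mul, h]
    congr 3
    omega
  · omega

/-! ### Ideals generated by their elements in a smaller cyclotomic order -/

/-- The ideal `J` of `ℤ[ζ]` is generated by its elements in `ℤ[ζ ^ (2 ^ k)]`. -/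
def GeneratedAt {ζ : ℂ} (J : Ideal (IntAdjoin ζ)) (k : ℕ) : Prop :=
  J ≤ Ideal.span {x : IntAdjoin ζ | x ∈ J ∧ (x : ℂ) ∈ IntAdjoin (ζ ^ 2 ^ k)}

theorem intAdjoin_pow_le (ζ : ℂ) (a : ℕ) : IntAdjoin (ζ ^ a) ≤ IntAdjoin ζ := by
  refine Algebra.adjoin_le ?_
  rintro _ rfl
  exact pow_mem (Algebra.self_mem_adjoin_singleton ℤ ζ) a

namespace GeneratedAt

variable {ζ : ℂ}

theorem zero (J : Ideal (IntAdjoin ζ)) : GeneratedAt J 0 := fun x hx =>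
  Ideal.subset_span ⟨hx, by simp⟩

theorem one (k : ℕ) : GeneratedAt (1 : Ideal (IntAdjoin ζ)) k := by
  unfold GeneratedAt
  rw [Ideal.one_eq_top, top_le_iff, Ideal.eq_top_iff_one]
  exact Ideal.subset_span ⟨trivial, by simp [one_mem]⟩

theorem mul {J J' : Ideal (IntAdjoin ζ)} {k : ℕ} (h : GeneratedAt J k)
    (h' : GeneratedAt J' k) : GeneratedAt (J * J') k := by
  refine (Ideal.mul_mono h h').trans ?_
  rw [Ideal.span_mul_span']
  refine Ideal.span_mono ?_
  rintro _ ⟨x, hx, y, hy, rfl⟩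
  exact ⟨Ideal.mul_mem_mul hx.1 hy.1, by simpa using mul_mem hx.2 hy.2⟩

theorem prod {t : ℕ} {P : Fin t → Ideal (IntAdjoin ζ)} {k : ℕ}
    (h : ∀ i, GeneratedAt (P i) k) : GeneratedAt (∏ i, P i) k :=
  Finset.prod_induction _ (GeneratedAt · k) (fun _ _ => mul) (one k) fun i _ => h i

end GeneratedAt

/-- Separates the even from the odd powers of `b`. -/
theorem exists_eq_add_mul_of_mem_adjoin {b x : ℂ} (hx : x ∈ IntAdjoin b) :
    ∃ u ∈ IntAdjoin (b ^ 2), ∃ v ∈ IntAdjoin (b ^ 2), x = u + b * v := by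
  have hb : b ^ 2 ∈ IntAdjoin (b ^ 2) := Algebra.self_mem_adjoin_singleton ℤ _
  induction hx using Algebra.adjoin_induction with
  | mem x hx =>
    rw [Set.mem_singleton_iff] at hx
    exact ⟨0, zero_mem _, 1, one_mem _, by simp [hx]⟩
  | algebraMap c => exact ⟨_, Subalgebra.algebraMap_mem _ c, 0, zero_mem _, by simp⟩
  | add x y _ _ hx hy =>
    obtain ⟨u, hu, v, hv, rfl⟩ := hx
    obtain ⟨u', hu', v', hv', rfl⟩ := hy
    exact ⟨_, add_mem hu hu', _, add_mem hv hv', by ring⟩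
  | mul x y _ _ hx hy =>
    obtain ⟨u, hu, v, hv, rfl⟩ := hx
    obtain ⟨u', hu', v', hv', rfl⟩ := hy
    exact ⟨_, add_mem (mul_mem hu hu') (mul_mem hb (mul_mem hv hv')), _,
      add_mem (mul_mem hu hv') (mul_mem hv hu'), by ring⟩

theorem pow_eq_self_of_mem_adjoin {ζ η : ℂ} (hη : η ∈ IntAdjoin ζ) {D : Type*} [CommRing D]
    (φ : IntAdjoin ζ →+* D) (ψ : D →+* D) (h : ψ (φ ⟨η, hη⟩) = φ ⟨η, hη⟩)
    (x : IntAdjoin ζ) (hx : (x : ℂ) ∈ IntAdjoin η) : ψ (φ x) = φ x := by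
  suffices ∀ z ∈ IntAdjoin η, ∃ y : IntAdjoin ζ, (y : ℂ) = z ∧ ψ (φ y) = φ y by
    obtain ⟨y, hy, hyx⟩ := this _ hx
    rwa [Subtype.ext hy] at hyx
  intro z hz
  induction hz using Algebra.adjoin_induction with
  | mem z hz =>
    rw [Set.mem_singleton_iff] at hz
    exact ⟨⟨η, hη⟩, hz.symm, h⟩
  | algebraMap c => exact ⟨algebraMap ℤ _ c, rfl, by simp⟩
  | add x y _ _ hx hy =>
    obtain ⟨u, rfl, hu⟩ := hx
    obtain ⟨v, rfl, hv⟩ := hy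
    exact ⟨u + v, rfl, by simp [hu, hv]⟩
  | mul x y _ _ hx hy =>
    obtain ⟨u, rfl, hu⟩ := hx
    obtain ⟨v, rfl, hv⟩ := hy
    exact ⟨u * v, rfl, by simp [hu, hv]⟩

/-- Iterated Frobenius acts as conjugation of `ℤ[b]` over `ℤ[b²]`: it negates `φ b`, since `φ b ^ 2
^ (e + 1) = -1` and `v` is odd. The relation and its conjugate then separate the two parts. -/
theorem eq_zero_and_eq_zero_of_add_mul_eq_zero {ζ : ℂ} {D : Type*} [CommRing D] [IsDomain D]
    {p f e v : ℕ} (hp : p.Prime) (hp2 : p ≠ 2) [CharP D p] (φ : IntAdjoin ζ →+* D) (hv : Odd v)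
    (hf : p ^ f = 2 ^ (e + 1) * v + 1) {b x y : IntAdjoin ζ} (hb : b ^ 2 ^ (e + 1) = -1)
    (hx : (x : ℂ) ∈ IntAdjoin ((b : ℂ) ^ 2)) (hy : (y : ℂ) ∈ IntAdjoin ((b : ℂ) ^ 2))
    (h0 : φ x + φ b * φ y = 0) : φ x = 0 ∧ φ y = 0 := by
  have : ExpChar D p := ExpChar.prime hp
  let ψ := iterateFrobenius D p f
  have hφb : φ b ^ 2 ^ (e + 1) = -1 := by rw [← map_pow, hb, map_neg, map_one]
  have hψb : ψ (φ b) = -φ b := by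
    rw [iterateFrobenius_def, hf, pow_succ, pow_mul, hφb, hv.neg_one_pow, neg_one_mul]
  have hfix := pow_eq_self_of_mem_adjoin (η := (b : ℂ) ^ 2) (pow_mem b.2 2) φ ψ (by
    change ψ (φ (b ^ 2)) = φ (b ^ 2)
    rw [map_pow, map_pow, hψb, neg_sq])
  have h1 : φ x - φ b * φ y = 0 := by
    have := congrArg ψ h0
    rw [map_add, map_mul, hψb, hfix x hx, hfix y hy, map_zero] at this
    rw [← this]
    ring
  have htwo : (2 : D) ≠ 0 := by
    intro h2
    have : p ∣ 2 := (CharP.cast_eq_zero_iff D p 2).1 (by exact_mod_cast h2)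
    exact hp2 ((Nat.prime_dvd_prime_iff_eq hp Nat.prime_two).1 this)
  have hb0 : φ b ≠ 0 := by
    intro hb0
    rw [hb0, zero_pow (by positivity), zero_eq_neg] at hφb
    exact one_ne_zero hφb
  have hy0 : φ y = 0 := by
    have : 2 * (φ b * φ y) = 0 := by linear_combination h0 - h1
    simpa [htwo, hb0] using this
  exact ⟨by simpa [hy0] using h0, hy0⟩

theorem mem_and_mem_of_add_mul_mem {ζ : ℂ} {P : Ideal (IntAdjoin ζ)} (hP : P.IsPrime)
    {p f e v : ℕ} (hp : p.Prime) (hp2 : p ≠ 2) (hpP : (p : IntAdjoin ζ) ∈ P) (hv : Odd v)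
    (hf : p ^ f = 2 ^ (e + 1) * v + 1) {b x y : IntAdjoin ζ} (hb : b ^ 2 ^ (e + 1) = -1)
    (hx : (x : ℂ) ∈ IntAdjoin ((b : ℂ) ^ 2)) (hy : (y : ℂ) ∈ IntAdjoin ((b : ℂ) ^ 2))
    (h : x + b * y ∈ P) : x ∈ P ∧ y ∈ P := by
  have hp0 : ((p : ℕ) : IntAdjoin ζ ⧸ P) = 0 := by
    rw [← map_natCast (Ideal.Quotient.mk P)]
    exact Ideal.Quotient.eq_zero_iff_mem.2 hpP
  have : CharP (IntAdjoin ζ ⧸ P) p := (CharP.charP_iff_prime_eq_zero hp).2 hp0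
  simp only [← Ideal.Quotient.eq_zero_iff_mem, map_add, map_mul] at h ⊢
  exact eq_zero_and_eq_zero_of_add_mul_eq_zero hp hp2 (Ideal.Quotient.mk P) hv hf hb hx hy h

theorem pow_two_pow_eq_neg_one {n : ℕ} {ζ : ℂ} (hζ : IsPrimitiveRoot ζ (2 ^ (n + 1))) :
    ζ ^ 2 ^ n = -1 :=
  (hζ.pow (b := 2) (by positivity) (pow_succ _ _)).eq_neg_one_of_two_right

theorem GeneratedAt.of_isPrime {n : ℕ} {ζ : ℂ} (hζ : IsPrimitiveRoot ζ (2 ^ (n + 1)))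
    {P : Ideal (IntAdjoin ζ)} (hP : P.IsPrime) {p A m : ℕ} (hp : p.Prime)
    (hpP : (p : IntAdjoin ζ) ∈ P) (hm : Odd m) (hA1 : p % 4 = 1 → p = 2 ^ A * m + 1)
    (hA3 : p % 4 = 3 → p + 1 = 2 ^ A * m) {k : ℕ} (hk : k ≤ n - primeExp n p A) :
    GeneratedAt P k := by
  induction k with
  | zero => exact GeneratedAt.zero P
  | succ k ih =>
    refine (ih (by omega)).trans (Ideal.span_le.2 ?_)
    rintro x ⟨hxP, hx⟩
    -- With `b = ζ ^ 2 ^ k` one has `b ^ 2 ^ (n - k) = -1`, so `s + 1 = n - k`; the bound on `k + 1`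
    -- says that `s` is still at least `primeExp`.
    obtain ⟨hp2, f, v, hv, hf⟩ := exists_pow_eq_of_primeExp (n := n) (s := n - k - 1) hm hA1 hA3
      (by omega) (by omega)
    obtain ⟨y, hy, z, hz, hxyz⟩ := exists_eq_add_mul_of_mem_adjoin hx
    have hle : IntAdjoin ((ζ ^ 2 ^ k) ^ 2) ≤ IntAdjoin ζ := by
      rw [← pow_mul]
      exact intAdjoin_pow_le _ _
    let b : IntAdjoin ζ := ⟨ζ ^ 2 ^ k, pow_mem (Algebra.self_mem_adjoin_singleton ℤ ζ) _⟩
    have hb : b ^ 2 ^ (n - k - 1 + 1) = -1 := by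
      refine Subtype.ext ?_
      change (ζ ^ 2 ^ k) ^ 2 ^ (n - k - 1 + 1) = -1
      rw [← pow_mul, ← pow_add, show k + (n - k - 1 + 1) = n by omega,
        pow_two_pow_eq_neg_one hζ]
    have hxe : x = ⟨y, hle hy⟩ + b * ⟨z, hle hz⟩ := Subtype.ext hxyz
    obtain ⟨h1, h2⟩ := mem_and_mem_of_add_mul_mem hP hp hp2 hpP hv hf hb
      (x := ⟨y, hle hy⟩) (y := ⟨z, hle hz⟩) hy hz (hxe ▸ hxP)
    have hsq : (ζ ^ 2 ^ k) ^ 2 = ζ ^ 2 ^ (k + 1) := by rw [← pow_mul, ← pow_succ]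
    rw [hsq] at hy hz
    rw [hxe]
    exact add_mem (Ideal.subset_span ⟨h1, hy⟩)
      (Ideal.mul_mem_left _ _ (Ideal.subset_span ⟨h2, hz⟩))

/-! ### Splitting the coordinates by residue classes modulo `2 ^ (n - r)` -/

/-- The bijection `(j, k) ↦ 2 ^ (n - r) * j + k`. -/
def splitIndex {n r : ℕ} (h : r ≤ n) : Fin (2 ^ r) × Fin (2 ^ (n - r)) ≃ Fin (2 ^ n) :=
  finProdFinEquiv.trans (finCongr (by rw [← pow_add]; congr; omega))

theorem splitIndex_val {n r : ℕ} (h : r ≤ n) (j : Fin (2 ^ r)) (k : Fin (2 ^ (n - r))) :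
    (splitIndex h (j, k) : ℕ) = k + 2 ^ (n - r) * j := rfl

theorem splitIndex_zero {n r : ℕ} (h : r ≤ n) (j : Fin (2 ^ r)) :
    splitIndex h (j, 0) = spreadIndex n r j := by
  have hv := splitIndex_val h j 0
  have hlt := (splitIndex h (j, 0)).isLt
  ext
  simp only [Fin.coe_ofNat_eq_mod, Nat.zero_mod, zero_add] at hv
  rw [hv] at hlt ⊢
  simp [spreadIndex, Nat.mod_eq_of_lt hlt]

theorem splitIndex_zero_lt {n r : ℕ} (h : r ≤ n) {i j : Fin (2 ^ r)} :
    splitIndex h (i, 0) < splitIndex h (j, 0) ↔ i < j := by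
  rw [Fin.lt_def, splitIndex_val, splitIndex_val, Fin.lt_def]
  simp

/-- The coordinates at the positions congruent to `k` modulo `2 ^ (n - r)`. -/
noncomputable def component {n r : ℕ} (h : r ≤ n) (k : Fin (2 ^ (n - r)))
    (v : EuclideanSpace ℝ (Fin (2 ^ n))) : EuclideanSpace ℝ (Fin (2 ^ r)) :=
  WithLp.toLp 2 fun j => v (splitIndex h (j, k))

/-- The vector with entries `w` at the positions congruent to `k` modulo `2 ^ (n - r)`, and zeros
elsewhere. -/
noncomputable def spread {n r : ℕ} (h : r ≤ n) (k : Fin (2 ^ (n - r)))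
    (w : EuclideanSpace ℝ (Fin (2 ^ r))) : EuclideanSpace ℝ (Fin (2 ^ n)) :=
  WithLp.toLp 2 fun i =>
    if ((splitIndex h).symm i).2 = k then w ((splitIndex h).symm i).1 else 0

section

variable {n r : ℕ} (h : r ≤ n)

theorem component_apply (k : Fin (2 ^ (n - r))) (v : EuclideanSpace ℝ (Fin (2 ^ n)))
    (j : Fin (2 ^ r)) : component h k v j = v (splitIndex h (j, k)) := rfl

theorem spread_splitIndex (k l : Fin (2 ^ (n - r))) (w : EuclideanSpace ℝ (Fin (2 ^ r)))
    (j : Fin (2 ^ r)) : spread h k w (splitIndex h (j, l)) = if l = k then w j else 0 := by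
  simp [spread]

theorem component_spread (k l : Fin (2 ^ (n - r))) (w : EuclideanSpace ℝ (Fin (2 ^ r))) :
    component h l (spread h k w) = if l = k then w else 0 := by
  ext j
  rw [component_apply, spread_splitIndex]
  split_ifs <;> rfl

theorem ext_component {v w : EuclideanSpace ℝ (Fin (2 ^ n))}
    (hvw : ∀ k, component h k v = component h k w) : v = w := by
  ext i
  obtain ⟨⟨j, k⟩, rfl⟩ := (splitIndex h).surjective i
  exact congrArg (· j) (hvw k)

theorem inner_eq_sum_component (v w : EuclideanSpace ℝ (Fin (2 ^ n))) :
    inner ℝ v w = ∑ k, inner ℝ (component h k v) (component h k w) := by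
  simp only [PiLp.inner_apply]
  rw [← (splitIndex h).sum_comp, Fintype.sum_prod_type_right]
  rfl

theorem norm_sq_eq_sum_component (v : EuclideanSpace ℝ (Fin (2 ^ n))) :
    ‖v‖ ^ 2 = ∑ k, ‖component h k v‖ ^ 2 := by
  simp only [← real_inner_self_eq_norm_sq]
  exact inner_eq_sum_component h v v

theorem norm_component_le (k : Fin (2 ^ (n - r))) (v : EuclideanSpace ℝ (Fin (2 ^ n))) :
    ‖component h k v‖ ≤ ‖v‖ := by
  rw [← sq_le_sq₀ (norm_nonneg _) (norm_nonneg _), norm_sq_eq_sum_component h v]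
  exact Finset.single_le_sum (f := fun k => ‖component h k v‖ ^ 2) (fun _ _ => sq_nonneg _)
    (Finset.mem_univ k)

theorem norm_spread (k : Fin (2 ^ (n - r))) (w : EuclideanSpace ℝ (Fin (2 ^ r))) :
    ‖spread h k w‖ = ‖w‖ := by
  rw [← sq_eq_sq₀ (norm_nonneg _) (norm_nonneg _), norm_sq_eq_sum_component h,
    Finset.sum_eq_single k]
  · simp [component_spread]
  · intro l _ hl
    simp [component_spread, hl]
  · simp

theorem spread_ne_zero {k : Fin (2 ^ (n - r))} {w : EuclideanSpace ℝ (Fin (2 ^ r))}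
    (hw : w ≠ 0) : spread h k w ≠ 0 := by
  rw [← norm_ne_zero_iff, norm_spread]
  exact norm_ne_zero_iff.2 hw

theorem intVec_zeroPad (w : Fin (2 ^ r) → ℤ) : intVec (zeroPad n r w) = spread h 0 (intVec w) := by
  ext i
  obtain ⟨⟨j, k⟩, rfl⟩ := (splitIndex h).surjective i
  rw [spread_splitIndex]
  simp [intVec, zeroPad, ← splitIndex_zero h, Prod.ext_iff, ite_and, eq_comm (a := k)]

theorem component_zero_intVec (v : Fin (2 ^ n) → ℤ) :
    component h 0 (intVec v) = intVec fun j => v (spreadIndex n r j) := by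
  ext j
  rw [component_apply, splitIndex_zero]
  rfl

/-! ### Shortest vectors of an orthogonal sum of copies of a lattice -/

variable {h} {Λ : Submodule ℤ (EuclideanSpace ℝ (Fin (2 ^ n)))}
  {Λ' : Submodule ℤ (EuclideanSpace ℝ (Fin (2 ^ r)))}

theorem spread_mem (H : ∀ v, v ∈ Λ ↔ ∀ k, component h k v ∈ Λ') (k : Fin (2 ^ (n - r)))
    {w : EuclideanSpace ℝ (Fin (2 ^ r))} (hw : w ∈ Λ') : spread h k w ∈ Λ := by
  refine (H _).2 fun l => ?_
  rw [component_spread]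
  split_ifs
  exacts [hw, zero_mem _]

/-- Any nonzero component of `v` serves as the witness. -/
theorem exists_norm_le (H : ∀ v, v ∈ Λ ↔ ∀ k, component h k v ∈ Λ')
    {v : EuclideanSpace ℝ (Fin (2 ^ n))} (hv : v ∈ Λ) (hv0 : v ≠ 0) :
    ∃ w ∈ Λ', w ≠ 0 ∧ ‖w‖ ≤ ‖v‖ := by
  by_contra! hc
  refine hv0 (ext_component h fun k => ?_)
  by_contra hk
  refine absurd (hc _ ((H v).1 hv k) ?_) (not_lt.2 (norm_component_le h k v))
  exact hk

theorem IsShortest.spread (H : ∀ v, v ∈ Λ ↔ ∀ k, component h k v ∈ Λ')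
    (k : Fin (2 ^ (n - r))) {w : EuclideanSpace ℝ (Fin (2 ^ r))} (hw : IsShortest Λ' w) :
    IsShortest Λ (spread h k w) := by
  refine ⟨spread_mem H k hw.1, spread_ne_zero h hw.2.1, fun v hv hv0 => ?_⟩
  obtain ⟨u, hu, hu0, huv⟩ := exists_norm_le H hv hv0
  rw [norm_spread]
  exact (hw.2.2 u hu hu0).trans huv

theorem firstMin_eq (H : ∀ v, v ∈ Λ ↔ ∀ k, component h k v ∈ Λ') (hΛ' : Λ' ≠ ⊥) :
    firstMin Λ = firstMin Λ' := by
  obtain ⟨w, hw, hw0⟩ := Submodule.exists_mem_ne_zero_of_ne_bot hΛ'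
  have hbdd (d : ℕ) (Γ : Submodule ℤ (EuclideanSpace ℝ (Fin d))) :
      BddBelow {x : ℝ | ∃ v ∈ Γ, v ≠ 0 ∧ ‖v‖ = x} := by
    refine ⟨0, ?_⟩
    rintro _ ⟨v, _, _, rfl⟩
    exact norm_nonneg v
  apply le_antisymm
  · refine le_csInf ⟨_, w, hw, hw0, rfl⟩ ?_
    rintro _ ⟨u, hu, hu0, rfl⟩
    exact csInf_le (hbdd _ _) ⟨_, spread_mem H 0 hu, spread_ne_zero h hu0, norm_spread h 0 u⟩
  · refine le_csInf ⟨_, _, spread_mem H 0 hw, spread_ne_zero h hw0, rfl⟩ ?_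
    rintro _ ⟨v, hv, hv0, rfl⟩
    obtain ⟨u, hu, hu0, huv⟩ := exists_norm_le H hv hv0
    exact (csInf_le (hbdd _ _) ⟨u, hu, hu0, rfl⟩).trans huv

end

/-! ### Lower triangular bases -/

theorem mem_rowLattice {d : ℕ} {B : Matrix (Fin d) (Fin d) ℤ} {v : EuclideanSpace ℝ (Fin d)} :
    v ∈ rowLattice B ↔ ∃ c : Fin d → ℤ, intVec (Matrix.vecMul c B) = v := by
  rw [rowLattice, Submodule.mem_span_range_iff_exists_fun]
  refine exists_congr fun c => Eq.congr_left ?_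
  ext i
  simp [intVec, Matrix.vecMul, dotProduct]

theorem intVec_injective {d : ℕ} : Function.Injective (intVec (d := d)) := by
  intro v w hvw
  ext i
  exact Int.cast_injective (α := ℝ) (congrArg (· i) hvw)

/-- Nonzero multiples of the unit vectors in the row lattice give `C * B = diagonal c` with nonzero
determinant. -/
theorem det_ne_zero_of_rowLattice {d : ℕ} {B : Matrix (Fin d) (Fin d) ℤ}
    (hB : ∀ i, ∃ c : ℤ, c ≠ 0 ∧ intVec (Pi.single i c) ∈ rowLattice B) : B.det ≠ 0 := by
  choose c hc hmem using hB
  choose C hC using fun i => mem_rowLattice.1 (hmem i)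
  have hCB : Matrix.of C * B = Matrix.diagonal c := by
    ext i j
    have := congrFun (intVec_injective (hC i)) j
    rw [Matrix.mul_apply_eq_vecMul]
    refine Eq.trans this ?_
    simp only [Matrix.diagonal_apply, Pi.single_apply, eq_comm]
  intro h0
  have := congrArg Matrix.det hCB
  rw [Matrix.det_mul, h0, mul_zero, Matrix.det_diagonal, eq_comm, Finset.prod_eq_zero_iff] at this
  obtain ⟨i, _, hi⟩ := this
  exact hc i hi

theorem det_eq_prod_diag {d : ℕ} {B : Matrix (Fin d) (Fin d) ℤ}
    (htri : ∀ i j, i < j → B i j = 0) : B.det = ∏ i, B i i :=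
  Matrix.det_of_isLowerTriangular B fun i j hij => htri i j hij

/-- Back substitution: working down from the last column, the vanishing coordinates force `c l = 0`
for all `l > a`. -/
theorem vecMul_apply_of_lowerTriangular {d : ℕ} {B : Matrix (Fin d) (Fin d) ℤ}
    (htri : ∀ i j, i < j → B i j = 0) (hdiag : ∀ i, B i i ≠ 0) {c : Fin d → ℤ} {a : Fin d}
    (hc : ∀ i, a < i → Matrix.vecMul c B i = 0) : Matrix.vecMul c B a = c a * B a a := by
  have key (i : Fin d) (hi : ∀ l, i < l → c l = 0) : Matrix.vecMul c B i = c i * B i i := by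
    refine Finset.sum_eq_single i (fun l _ hl => ?_) fun hi => absurd (Finset.mem_univ i) hi
    change c l * B l i = 0
    rcases lt_or_gt_of_ne hl with hl | hl
    · rw [htri _ _ hl, mul_zero]
    · rw [hi _ hl, zero_mul]
  refine key a fun l => ?_
  induction l using WellFoundedGT.induction with
  | ind l ih =>
    intro hal
    have := key l fun i hi => ih i hi (hal.trans hi)
    rw [hc l hal, eq_comm, mul_eq_zero] at this
    exact this.resolve_right (hdiag l)

theorem rowLattice_submatrix {n r : ℕ} {h : r ≤ n}
    {Λ : Submodule ℤ (EuclideanSpace ℝ (Fin (2 ^ n)))}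
    {Λ' : Submodule ℤ (EuclideanSpace ℝ (Fin (2 ^ r)))}
    (H : ∀ v, v ∈ Λ ↔ ∀ k, component h k v ∈ Λ')
    (hΛ : ∀ i, ∃ c : ℤ, c ≠ 0 ∧ intVec (Pi.single i c) ∈ Λ)
    {B : Matrix (Fin (2 ^ n)) (Fin (2 ^ n)) ℤ} (htri : ∀ i j, i < j → B i j = 0)
    (hB : rowLattice B = Λ) :
    (B.submatrix (spreadIndex n r) (spreadIndex n r)).det ≠ 0 ∧
      rowLattice (B.submatrix (spreadIndex n r) (spreadIndex n r)) = Λ' := by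
  have hdiag : ∀ i, B i i ≠ 0 := by
    have hdet := det_ne_zero_of_rowLattice (hB ▸ hΛ)
    rw [det_eq_prod_diag htri, Finset.prod_ne_zero_iff] at hdet
    exact fun i => hdet i (Finset.mem_univ i)
  set B' := B.submatrix (spreadIndex n r) (spreadIndex n r) with hB'
  have htri' : ∀ i j, i < j → B' i j = 0 := by
    intro i j hij
    rw [hB', Matrix.submatrix_apply, ← splitIndex_zero h, ← splitIndex_zero h]
    exact htri _ _ ((splitIndex_zero_lt h).2 hij)
  have hrow (j : Fin (2 ^ r)) : intVec (B' j) ∈ Λ' := by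
    have : intVec (B (spreadIndex n r j)) ∈ Λ := hB ▸ Submodule.subset_span ⟨_, rfl⟩
    have := (H _).1 this 0
    rwa [component_zero_intVec] at this
  refine ⟨?_, le_antisymm (Submodule.span_le.2 (by rintro _ ⟨j, rfl⟩; exact hrow j)) ?_⟩
  · rw [det_eq_prod_diag htri']
    exact Finset.prod_ne_zero_iff.2 fun j _ => hdiag _
  -- Induction on the length of the support: the triangular basis of `Λ`, applied to `spread h 0 w`,
  -- shows that the last entry of `w` is an integer multiple of the diagonal entry of `B'`.
  -- Subtracting that multiple of the row shortens `w`; only the one coefficient `a` of `c` is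
  -- needed.
  · suffices ∀ J : ℕ, ∀ w ∈ Λ', (∀ l : Fin (2 ^ r), J ≤ l → w l = 0) → w ∈ rowLattice B' from
      fun w hw => this (2 ^ r) w hw fun l hl => absurd l.isLt (not_lt.2 hl)
    intro J
    induction J with
    | zero =>
      intro w _ hw0
      have : w = 0 := by
        ext l
        exact hw0 l (Nat.zero_le _)
      exact this ▸ zero_mem _
    | succ J ih =>
      intro w hw hw0
      by_cases hJ : 2 ^ r ≤ J
      · exact ih w hw fun l hl => absurd l.isLt (by omega)
      let j : Fin (2 ^ r) := ⟨J, by omega⟩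
      obtain ⟨c, hc⟩ := mem_rowLattice.1 (hB ▸ spread_mem H 0 hw)
      have hcoord (i : Fin (2 ^ n)) : ((Matrix.vecMul c B i : ℤ) : ℝ) = spread h 0 w i :=
        congrArg (· i) hc
      have hlast := vecMul_apply_of_lowerTriangular htri hdiag (c := c)
        (a := splitIndex h (j, 0)) (by
          intro i hi
          obtain ⟨⟨l, k⟩, rfl⟩ := (splitIndex h).surjective i
          have := hcoord (splitIndex h (l, k))
          rw [spread_splitIndex] at this
          split_ifs at this with hk
          · subst hk
            rw [hw0 l ((splitIndex_zero_lt h).1 hi)] at this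
            exact_mod_cast this
          · exact_mod_cast this)
      set a := c (splitIndex h (j, 0))
      have hwj : w j = a * B' j j := by
        have := hcoord (splitIndex h (j, 0))
        rw [spread_splitIndex, if_pos rfl, hlast] at this
        rw [← this, splitIndex_zero, hB', Matrix.submatrix_apply]
        push_cast
        rfl
      have hsub : w - a • intVec (B' j) ∈ rowLattice B' := by
        refine ih _ (sub_mem hw (Submodule.smul_mem _ _ (hrow j))) fun l hl => ?_
        have : (w - a • intVec (B' j)) l = w l - a * B' j l := by simp [intVec]
        rw [this]
        rcases hl.eq_or_lt with hl | hl
        · rw [show l = j from Fin.ext hl.symm, hwj, sub_self]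
        · rw [hw0 l hl, htri' j l hl]
          simp
      have := add_mem hsub (Submodule.smul_mem _ a (Submodule.subset_span ⟨j, rfl⟩))
      simpa using this

/-! ### The direct sum decomposition -/

theorem mem_idealModule {ζ : ℂ} {J : Ideal (IntAdjoin ζ)} {x : ℂ} :
    x ∈ idealModule J ↔ ∃ y ∈ J, (y : ℂ) = x := Iff.rfl

theorem coe_mem_idealModule {ζ : ℂ} {J : Ideal (IntAdjoin ζ)} {x : IntAdjoin ζ} :
    (x : ℂ) ∈ idealModule J ↔ x ∈ J := by
  rw [mem_idealModule]
  exact ⟨fun ⟨_, hy, hyx⟩ => Subtype.ext hyx ▸ hy, fun hx => ⟨x, hx, rfl⟩⟩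

theorem mul_mem_idealModule {ζ : ℂ} {J : Ideal (IntAdjoin ζ)} {a x : ℂ} (ha : a ∈ IntAdjoin ζ)
    (hx : x ∈ idealModule J) : a * x ∈ idealModule J := by
  obtain ⟨y, hy, rfl⟩ := mem_idealModule.1 hx
  exact mem_idealModule.2 ⟨⟨a, ha⟩ * y, J.mul_mem_left _ hy, rfl⟩

theorem mem_mulPow {ζ : ℂ} {k : ℕ} {S : Submodule ℤ ℂ} {x : ℂ} :
    x ∈ mulPow ζ k S ↔ ∃ y ∈ S, ζ ^ k * y = x := Iff.rfl

theorem mem_iSup_mulPow {ζ : ℂ} {N : ℕ} {S : Submodule ℤ ℂ} {x : ℂ} :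
    x ∈ ⨆ k : Fin N, mulPow ζ k S ↔
      ∃ a : Fin N → ℂ, (∀ k, a k ∈ S) ∧ ∑ k : Fin N, ζ ^ (k : ℕ) * a k = x := by
  constructor
  · intro hx
    obtain ⟨f, hf, hfx⟩ := (Submodule.mem_iSup_iff_exists_finsupp _ _).1 hx
    choose a ha hfa using fun k => mem_mulPow.1 (hf k)
    refine ⟨a, ha, ?_⟩
    rw [← hfx, Finsupp.sum_fintype _ _ fun _ => rfl]
    exact Finset.sum_congr rfl fun k _ => hfa k
  · rintro ⟨a, ha, rfl⟩
    exact Submodule.sum_mem _ fun k _ => Submodule.mem_iSup_of_mem k ⟨a k, ha k, rfl⟩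

/-- The sum is stable under multiplication by `ζ`, hence by `ℤ[ζ]`, and its zeroth summand contains
the generators of `J`. -/
theorem iSup_mulPow_eq_idealModule {ζ : ℂ} {J : Ideal (IntAdjoin ζ)} {k : ℕ}
    (hJ : GeneratedAt J k) :
    ⨆ i : Fin (2 ^ k), mulPow ζ i
      (idealModule J ⊓ Subalgebra.toSubmodule (IntAdjoin (ζ ^ 2 ^ k))) = idealModule J := by
  have hζ : ζ ∈ IntAdjoin ζ := Algebra.self_mem_adjoin_singleton ℤ ζ
  set T := ⨆ i : Fin (2 ^ k), mulPow ζ i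
      (idealModule J ⊓ Subalgebra.toSubmodule (IntAdjoin (ζ ^ 2 ^ k))) with hT
  refine le_antisymm (iSup_le fun i => ?_) ?_
  · rintro _ ⟨x, hx, rfl⟩
    exact mul_mem_idealModule (pow_mem hζ _) hx.1
  have hζT : ∀ x ∈ T, ζ * x ∈ T := by
    intro x hx
    rw [hT] at hx
    induction hx using Submodule.iSup_induction' with
    | mem i x hx =>
      obtain ⟨y, hy, rfl⟩ := mem_mulPow.1 hx
      rw [← mul_assoc, ← pow_succ']
      by_cases hi : (i : ℕ) + 1 < 2 ^ k
      · exact Submodule.mem_iSup_of_mem ⟨i + 1, hi⟩ ⟨y, hy, rfl⟩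
      -- Wrap-around: `ζ ^ 2 ^ k` already lies in the small order, so the product returns to the
      -- zeroth summand.
      · refine Submodule.mem_iSup_of_mem 0 ⟨ζ ^ ((i : ℕ) + 1) * y, ?_, by simp⟩
        have hi' : (i : ℕ) + 1 = 2 ^ k := by omega
        refine ⟨mul_mem_idealModule (pow_mem hζ _) hy.1, ?_⟩
        rw [hi']
        exact (IntAdjoin (ζ ^ 2 ^ k)).mul_mem (Algebra.self_mem_adjoin_singleton ℤ _) hy.2
    | zero => simp
    | add x y _ _ hx hy =>
      rw [mul_add]
      exact add_mem hx hy
  have hmul : ∀ a ∈ IntAdjoin ζ, ∀ x ∈ T, a * x ∈ T := by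
    intro a ha
    induction ha using Algebra.adjoin_induction with
    | mem a ha =>
      rw [Set.mem_singleton_iff] at ha
      exact ha ▸ hζT
    | algebraMap c =>
      intro x hx
      simpa using T.smul_mem c hx
    | add a b _ _ ha hb =>
      intro x hx
      rw [add_mul]
      exact add_mem (ha x hx) (hb x hx)
    | mul a b _ _ ha hb =>
      intro x hx
      rw [mul_assoc]
      exact ha _ (hb x hx)
  rintro _ ⟨x, hx, rfl⟩
  change (x : ℂ) ∈ T
  refine Submodule.span_induction (R := IntAdjoin ζ) (M := IntAdjoin ζ)
    (p := fun x _ => (x : ℂ) ∈ T) (fun x hx => ?_) T.zero_mem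
    (fun x y _ _ hx hy => T.add_mem hx hy) (fun a x _ hx => hmul a a.2 x hx) (hJ hx)
  exact Submodule.mem_iSup_of_mem 0 ⟨x, ⟨coe_mem_idealModule.2 hx.1, hx.2⟩, by simp⟩

/-! ### The ring of integers -/

theorem integersModule_adjoin {s : ℕ} {α : ℂ} (hα : IsPrimitiveRoot α (2 ^ (s + 1))) :
    integersModule ℚ⟮α⟯ = Subalgebra.toSubmodule (IntAdjoin α) := by
  let g := IntermediateField.AdjoinSimple.gen ℚ α
  have hg : IsPrimitiveRoot g (2 ^ (s + 1)) :=
    IsPrimitiveRoot.of_map_of_injective (f := ℚ⟮α⟯.val) (by simpa [g] using hα)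
      ℚ⟮α⟯.val.injective
  have halg : IsAlgebraic ℚ α := ((hα.isIntegral (by positivity)).tower_top (A := ℚ)).isAlgebraic
  have hcyc : IsCyclotomicExtension {2 ^ (s + 1)} ℚ ℚ⟮α⟯ := by
    change IsCyclotomicExtension {2 ^ (s + 1)} ℚ ℚ⟮α⟯.toSubalgebra
    rw [IntermediateField.adjoin_simple_toSubalgebra_of_isAlgebraic halg]
    exact hα.adjoin_isCyclotomicExtension ℚ
  have hcl := IsCyclotomicExtension.Rat.isIntegralClosure_adjoin_singleton_of_prime_pow hg
  let f : ℚ⟮α⟯ →ₐ[ℤ] ℂ := ℚ⟮α⟯.val.restrictScalars ℤ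
  have hmap : (Algebra.adjoin ℤ {g}).map f = IntAdjoin α := by
    rw [AlgHom.map_adjoin, Set.image_singleton]
    rfl
  ext x
  rw [← hmap]
  constructor
  · rintro ⟨y, hy, rfl⟩
    obtain ⟨z, rfl⟩ := (hcl.isIntegral_iff (x := y)).1 hy
    exact ⟨z, z.2, rfl⟩
  · rintro ⟨y, hy, rfl⟩
    exact ⟨y, (hcl.isIntegral_iff (x := y)).2 ⟨⟨y, hy⟩, rfl⟩, rfl⟩

/-! ### Coefficient vectors -/

theorem mem_coeffLattice {s : ℕ} {α : ℂ} {hα : IsPrimitiveRoot α (2 ^ (s + 1))}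
    {S : Submodule ℤ ℂ} {v : EuclideanSpace ℝ (Fin (2 ^ s))} :
    v ∈ coeffLattice hα S ↔ ∃ x : ℚ⟮α⟯, (x : ℂ) ∈ S ∧ coeffEmbedding hα x = v := Iff.rfl

theorem coeffEmbedding_injective {s : ℕ} {α : ℂ} (hα : IsPrimitiveRoot α (2 ^ (s + 1))) :
    Function.Injective (coeffEmbedding hα) := by
  intro x y hxy
  refine (powerBasis hα).repr.injective (Finsupp.ext fun i => ?_)
  exact Rat.cast_injective (α := ℝ) (congrArg (· i) hxy)

theorem coe_eq_sum_repr {s : ℕ} {α : ℂ} (hα : IsPrimitiveRoot α (2 ^ (s + 1))) (x : ℚ⟮α⟯) :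
    (x : ℂ) = ∑ i, (((powerBasis hα).repr x i : ℚ) : ℂ) * α ^ (i : ℕ) := by
  conv_lhs => rw [← (powerBasis hα).sum_repr x]
  rw [IntermediateField.coe_sum]
  refine Finset.sum_congr rfl fun i _ => ?_
  rw [IntermediateField.coe_smul, powerBasis_apply, Rat.smul_def]

theorem repr_eq_of_coe_eq_sum {s : ℕ} {α : ℂ} (hα : IsPrimitiveRoot α (2 ^ (s + 1))) {x : ℚ⟮α⟯}
    {c : Fin (2 ^ s) → ℚ} (h : (x : ℂ) = ∑ i, (c i : ℂ) * α ^ (i : ℕ)) (i : Fin (2 ^ s)) :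
    (powerBasis hα).repr x i = c i := by
  have : x = ∑ i, c i • powerBasis hα i := by
    refine Subtype.ext (h.trans ?_)
    rw [IntermediateField.coe_sum]
    refine Finset.sum_congr rfl fun i _ => ?_
    rw [IntermediateField.coe_smul, powerBasis_apply, Rat.smul_def]
  rw [this, Module.Basis.repr_sum_self]

theorem coeffEmbedding_eq_intVec {s : ℕ} {α : ℂ} (hα : IsPrimitiveRoot α (2 ^ (s + 1)))
    {x : ℚ⟮α⟯} {c : Fin (2 ^ s) → ℤ} (h : (x : ℂ) = ∑ i, (c i : ℂ) * α ^ (i : ℕ)) :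
    coeffEmbedding hα x = intVec c := by
  ext i
  have := repr_eq_of_coe_eq_sum hα (c := fun i => (c i : ℚ)) (by simpa using h) i
  simp [coeffEmbedding, intVec, this]

theorem intVec_single_mem {s : ℕ} {α : ℂ} (hα : IsPrimitiveRoot α (2 ^ (s + 1)))
    {S : Submodule ℤ ℂ} {d : ℕ} (hS : ∀ i : ℕ, α ^ i * d ∈ S) (i : Fin (2 ^ s)) :
    intVec (Pi.single i (d : ℤ)) ∈ coeffLattice hα S := by
  refine mem_coeffLattice.2 ⟨powerBasis hα i * d, ?_, ?_⟩
  · simpa [powerBasis_apply] using hS i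
  · refine coeffEmbedding_eq_intVec hα ?_
    rw [Finset.sum_eq_single i]
    · simp [powerBasis_apply, mul_comm]
    · intro j _ hj
      simp [hj]
    · simp

theorem exists_coeffEmbedding_eq_intVec {s : ℕ} {α : ℂ} (hα : IsPrimitiveRoot α (2 ^ (s + 1)))
    {x : ℚ⟮α⟯} (hx : (x : ℂ) ∈ IntAdjoin α) : ∃ c, coeffEmbedding hα x = intVec c := by
  have hs : 2 ^ s ≠ 0 := by positivity
  -- Since `α` is a root of the monic integer polynomial `X ^ 2 ^ s + 1`, its first `2 ^ s` powers
  -- span `ℤ[α]` over `ℤ`.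
  have hspan := Submodule.span_range_natDegree_eq_adjoin (x := α)
    (f := (Polynomial.X ^ 2 ^ s + Polynomial.C 1 : Polynomial ℤ))
    (Polynomial.monic_X_pow_add_C 1 hs) (by simp [pow_two_pow_eq_neg_one hα])
  rw [← Subalgebra.mem_toSubmodule, ← hspan, Polynomial.natDegree_X_pow_add_C] at hx
  have hrange : ((Finset.image (α ^ ·) (Finset.range (2 ^ s)) : Finset ℂ) : Set ℂ) =
      Set.range fun i : Fin (2 ^ s) => α ^ (i : ℕ) := by
    ext z
    simp [Fin.exists_iff]
  rw [hrange, Submodule.mem_span_range_iff_exists_fun] at hx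
  obtain ⟨c, hc⟩ := hx
  exact ⟨c, coeffEmbedding_eq_intVec hα (by simpa using hc.symm)⟩

/-- Lying inside `ℤ ^ d` makes `Λ` discrete; containing a nonzero multiple of every unit vector
makes it span. -/
theorem exists_basis_of_intVec {d : ℕ} {Λ : Submodule ℤ (EuclideanSpace ℝ (Fin d))}
    (hint : ∀ v ∈ Λ, ∃ c, v = intVec c)
    (hmem : ∀ i, ∃ c : ℤ, c ≠ 0 ∧ intVec (Pi.single i c) ∈ Λ) :
    ∃ b : Module.Basis (Fin d) ℝ (EuclideanSpace ℝ (Fin d)),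
      Λ = Submodule.span ℤ (Set.range b) := by
  let e := (EuclideanSpace.basisFun (Fin d) ℝ).toBasis
  have hle : Λ ≤ Submodule.span ℤ (Set.range e) := by
    intro v hv
    obtain ⟨c, rfl⟩ := hint v hv
    rw [e.mem_span_iff_repr_mem ℤ]
    intro i
    exact ⟨c i, by simp [e, intVec]⟩
  have : DiscreteTopology Λ :=
    DiscreteTopology.of_subset (s := (Submodule.span ℤ (Set.range e) : Set _))
      (inferInstanceAs (DiscreteTopology (Submodule.span ℤ (Set.range e)))) hle
  have hspan : Submodule.span ℝ (Λ : Set (EuclideanSpace ℝ (Fin d))) = ⊤ := by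
    rw [← top_le_iff, ← e.span_eq, Submodule.span_le]
    rintro _ ⟨i, rfl⟩
    obtain ⟨c, hc, hci⟩ := hmem i
    have : e i = (c : ℝ)⁻¹ • intVec (Pi.single i c) := by
      ext j
      by_cases hj : j = i
      · subst hj
        simp [e, intVec, hc]
      · simp [e, intVec, hj]
    rw [this]
    exact Submodule.smul_mem _ _ (Submodule.subset_span hci)
  have : IsZLattice ℝ Λ := ⟨hspan⟩
  have : Module.Finite ℤ Λ := ZLattice.module_finite ℝ Λ
  have hrank : Module.finrank ℤ Λ = d := by
    rw [ZLattice.rank ℝ Λ, finrank_euclideanSpace_fin]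
  let b := (Module.finBasis ℤ Λ).reindex (finCongr hrank)
  exact ⟨b.ofZLatticeBasis ℝ Λ, (b.ofZLatticeBasis_span ℝ Λ).symm⟩

/-! ### Coefficients with respect to a subfield -/

section

variable {n r : ℕ} {ζ : ℂ} (hζ : IsPrimitiveRoot ζ (2 ^ (n + 1))) (h : r ≤ n)
  (hη : IsPrimitiveRoot (ζ ^ 2 ^ (n - r)) (2 ^ (r + 1)))

/-- Expanding each `y k` in powers of `η` and using `ζ ^ k η ^ j = ζ ^ (k + 2 ^ (n - r) j)` gives
the expansion of `z` in powers of `ζ`. -/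
theorem component_coeffEmbedding (y : Fin (2 ^ (n - r)) → ℚ⟮ζ ^ 2 ^ (n - r)⟯) {z : ℚ⟮ζ⟯}
    (hz : (z : ℂ) = ∑ k : Fin (2 ^ (n - r)), ζ ^ (k : ℕ) * (y k : ℂ)) (k : Fin (2 ^ (n - r))) :
    component h k (coeffEmbedding hζ z) = coeffEmbedding hη (y k) := by
  let e := splitIndex h
  have key := repr_eq_of_coe_eq_sum hζ (x := z)
    (c := fun i => (powerBasis hη).repr (y (e.symm i).2) (e.symm i).1) (by
      rw [hz, ← e.sum_comp, Fintype.sum_prod_type_right]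
      refine Finset.sum_congr rfl fun k _ => ?_
      rw [coe_eq_sum_repr hη (y k), Finset.mul_sum]
      refine Finset.sum_congr rfl fun j _ => ?_
      rw [Equiv.symm_apply_apply, splitIndex_val, pow_add, pow_mul]
      ring)
  ext j
  have := key (e (j, k))
  rw [Equiv.symm_apply_apply] at this
  exact congrArg (Rat.cast (K := ℝ)) this

theorem coeffEmbedding_eq_spread {x : ℚ⟮ζ ^ 2 ^ (n - r)⟯} {z : ℚ⟮ζ⟯} {k : Fin (2 ^ (n - r))}
    (hz : (z : ℂ) = ζ ^ (k : ℕ) * (x : ℂ)) :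
    coeffEmbedding hζ z = spread h k (coeffEmbedding hη x) := by
  refine ext_component h fun l => ?_
  rw [component_spread, component_coeffEmbedding hζ h hη (Pi.single k x)]
  · by_cases hl : l = k
    · subst hl
      simp
    · simp [hl]
  · rw [Finset.sum_eq_single k]
    · simpa using hz
    · intro l _ hl
      simp [hl]
    · simp

theorem pow_mul_mem_adjoin (k : ℕ) {x : ℂ} (hx : x ∈ ℚ⟮ζ ^ 2 ^ (n - r)⟯) :
    ζ ^ k * x ∈ ℚ⟮ζ⟯ := by
  have hζ : ζ ∈ ℚ⟮ζ⟯ := IntermediateField.mem_adjoin_simple_self ℚ ζ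
  refine mul_mem (pow_mem hζ k) (IntermediateField.adjoin_simple_le_iff.2 ?_ hx)
  exact pow_mem hζ _

variable {S : Submodule ℤ ℂ}

theorem mem_coeffLattice_iSup_mulPow (hS : ∀ x ∈ S, x ∈ ℚ⟮ζ ^ 2 ^ (n - r)⟯)
    (v : EuclideanSpace ℝ (Fin (2 ^ n))) :
    v ∈ coeffLattice hζ (⨆ k : Fin (2 ^ (n - r)), mulPow ζ k S) ↔
      ∀ k, component h k v ∈ coeffLattice hη S := by
  constructor
  · rintro ⟨z, hz, rfl⟩ k
    obtain ⟨a, ha, haz⟩ := mem_iSup_mulPow.1 hz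
    exact ⟨⟨a k, hS _ (ha k)⟩, ha k,
      (component_coeffEmbedding hζ h hη (fun k => ⟨a k, hS _ (ha k)⟩) haz.symm k).symm⟩
  · intro hv
    choose y hy hyv using fun k => mem_coeffLattice.1 (hv k)
    let z : ℚ⟮ζ⟯ := ∑ k, ⟨_, pow_mul_mem_adjoin (k : Fin (2 ^ (n - r))) (y k).2⟩
    have hz : (z : ℂ) = ∑ k : Fin (2 ^ (n - r)), ζ ^ (k : ℕ) * (y k : ℂ) :=
      IntermediateField.coe_sum _ _
    refine ⟨z, mem_iSup_mulPow.2 ⟨fun k => y k, hy, hz.symm⟩, ext_component h fun k => ?_⟩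
    exact (component_coeffEmbedding hζ h hη y hz k).trans (hyv k)

theorem component_eq_zero_of_mem_mulPow (hS : ∀ x ∈ S, x ∈ ℚ⟮ζ ^ 2 ^ (n - r)⟯)
    {k l : Fin (2 ^ (n - r))} (hkl : l ≠ k) {v : EuclideanSpace ℝ (Fin (2 ^ n))}
    (hv : v ∈ coeffLattice hζ (mulPow ζ k S)) : component h l v = 0 := by
  obtain ⟨z, hz, rfl⟩ := mem_coeffLattice.1 hv
  obtain ⟨x, hx, hxz⟩ := mem_mulPow.1 hz
  rw [coeffEmbedding_eq_spread hζ h (isPrimitiveRoot_pow hζ h) (x := ⟨x, hS x hx⟩) hxz.symm,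
    component_spread, if_neg hkl]

theorem inner_eq_zero_of_mem_mulPow (h : r ≤ n) (hS : ∀ x ∈ S, x ∈ ℚ⟮ζ ^ 2 ^ (n - r)⟯)
    {k l : Fin (2 ^ (n - r))} (hkl : k ≠ l)
    {u v : EuclideanSpace ℝ (Fin (2 ^ n))} (hu : u ∈ coeffLattice hζ (mulPow ζ k S))
    (hv : v ∈ coeffLattice hζ (mulPow ζ l S)) : inner ℝ u v = 0 := by
  rw [inner_eq_sum_component h]
  refine Finset.sum_eq_zero fun i _ => ?_
  by_cases hi : i = k
  · rw [component_eq_zero_of_mem_mulPow hζ h hS (hi ▸ hkl) hv, inner_zero_right]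
  · rw [component_eq_zero_of_mem_mulPow hζ h hS hi hu, inner_zero_left]

theorem iSupIndep_mulPow (hζ : IsPrimitiveRoot ζ (2 ^ (n + 1))) (h : r ≤ n)
    (hS : ∀ x ∈ S, x ∈ ℚ⟮ζ ^ 2 ^ (n - r)⟯) :
    iSupIndep fun k : Fin (2 ^ (n - r)) => mulPow ζ k S := by
  have hη := isPrimitiveRoot_pow hζ h
  rw [iSupIndep_iff_finsetSum_eq_zero_imp_eq_zero]
  intro s v hv hsum k hk
  choose! a ha hav using fun k hk => mem_mulPow.1 (hv k hk)
  -- Extending by zero outside `s` gives an expansion of `0` over all residue classes, whose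
  -- components must all vanish.
  let y (k : Fin (2 ^ (n - r))) : ℚ⟮ζ ^ 2 ^ (n - r)⟯ :=
    if hk : k ∈ s then ⟨a k, hS _ (ha k hk)⟩ else 0
  have hy (k : Fin (2 ^ (n - r))) (hk : k ∈ s) : (y k : ℂ) = a k := by simp [y, hk]
  have hz : ((0 : ℚ⟮ζ⟯) : ℂ) = ∑ k : Fin (2 ^ (n - r)), ζ ^ (k : ℕ) * (y k : ℂ) := by
    rw [← Finset.sum_subset s.subset_univ fun k _ hk => by simp [y, hk]]
    rw [ZeroMemClass.coe_zero, ← hsum]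
    exact Finset.sum_congr rfl fun k hk => by rw [hy k hk, hav k hk]
  have hyk := component_coeffEmbedding hζ h hη y hz k
  have hy0 : y k = 0 := by
    refine coeffEmbedding_injective hη (hyk.symm.trans ?_)
    rw [map_zero, map_zero]
    rfl
  rw [← hav k hk, ← hy k hk, hy0, ZeroMemClass.coe_zero, mul_zero]

theorem exists_isShortest_pow_mul
    {Λ : Submodule ℤ (EuclideanSpace ℝ (Fin (2 ^ n)))}
    {Λ' : Submodule ℤ (EuclideanSpace ℝ (Fin (2 ^ r)))}
    (H : ∀ v, v ∈ Λ ↔ ∀ k, component h k v ∈ Λ') {x : ℚ⟮ζ ^ 2 ^ (n - r)⟯}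
    (hx : IsShortest Λ' (coeffEmbedding hη x)) :
    ∃ y : Fin (2 ^ (n - r)) → ℚ⟮ζ⟯, Function.Injective y ∧
      ∀ k, (y k : ℂ) = ζ ^ (k : ℕ) * (x : ℂ) ∧ IsShortest Λ (coeffEmbedding hζ (y k)) := by
  refine ⟨fun k => ⟨_, pow_mul_mem_adjoin k x.2⟩, fun k l hkl => ?_, fun k => ⟨rfl, ?_⟩⟩
  · have hx0 : (x : ℂ) ≠ 0 := by
      rintro h0
      have : x = 0 := Subtype.ext h0
      exact hx.2.1 (by rw [this, map_zero])
    have hlt (k : Fin (2 ^ (n - r))) : (k : ℕ) < 2 ^ (n + 1) :=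
      k.isLt.trans_le (Nat.pow_le_pow_right two_pos (by omega))
    exact Fin.ext (hζ.pow_inj (hlt k) (hlt l)
      (mul_right_cancel₀ hx0 (congrArg Subtype.val hkl)))
  · rw [coeffEmbedding_eq_spread hζ h hη rfl]
    exact hx.spread H k

end

theorem interIntegers_eq {s : ℕ} {ζ α : ℂ} (hα : IsPrimitiveRoot α (2 ^ (s + 1)))
    (I : Ideal (IntAdjoin ζ)) :
    interIntegers I ℚ⟮α⟯ = idealModule I ⊓ Subalgebra.toSubmodule (IntAdjoin α) := by
  rw [interIntegers, integersModule_adjoin hα]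

theorem mem_field_of_mem_interIntegers {ζ : ℂ} {I : Ideal (IntAdjoin ζ)}
    {K : IntermediateField ℚ ℂ} {x : ℂ} (hx : x ∈ interIntegers I K) : x ∈ K := by
  obtain ⟨-, y, -, rfl⟩ := hx
  exact y.2

theorem pow_mul_mem_interIntegers {s a : ℕ} {ζ : ℂ} (hα : IsPrimitiveRoot (ζ ^ a) (2 ^ (s + 1)))
    {I : Ideal (IntAdjoin ζ)} {d : ℕ} (hd : (d : IntAdjoin ζ) ∈ I) (i : ℕ) :
    (ζ ^ a) ^ i * d ∈ interIntegers I ℚ⟮ζ ^ a⟯ := by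
  have hi : (ζ ^ a) ^ i ∈ IntAdjoin (ζ ^ a) :=
    pow_mem (Algebra.self_mem_adjoin_singleton ℤ _) i
  rw [interIntegers_eq hα]
  refine ⟨mul_mem_idealModule (intAdjoin_pow_le ζ a hi) (coe_mem_idealModule.2 hd), ?_⟩
  exact (IntAdjoin (ζ ^ a)).mul_mem hi (natCast_mem _ d)

end IdealSVP

theorem mainTheorem3
    (n : ℕ) (ζ : ℂ) (hζ : IsPrimitiveRoot ζ (2 ^ (n + 1)))
    (I : Ideal (IntAdjoin ζ))
    (t : ℕ) (P : Fin t → Ideal (IntAdjoin ζ)) (hP : ∀ i, (P i).IsPrime)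
    (hI : I = ∏ i, P i)
    (p A m : Fin t → ℕ)
    (hp : ∀ i, (p i).Prime) (hpP : ∀ i, ((p i : ℕ) : IntAdjoin ζ) ∈ P i)
    (hm : ∀ i, Odd (m i))
    (hA1 : ∀ i, p i % 4 = 1 → p i = 2 ^ A i * m i + 1)
    (hA3 : ∀ i, p i % 4 = 3 → p i + 1 = 2 ^ A i * m i)
    (r : ℕ) (hr : r = maxExp n p A) :
    let η : ℂ := ζ ^ 2 ^ (n - r)
    have hη : IsPrimitiveRoot η (2 ^ (r + 1)) :=
      isPrimitiveRoot_pow hζ (hr.le.trans (maxExp_le n p A))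
    -- `𝔠 = I ∩ O_K` with `K = ℚ(η)`; the lattice of `I` in dimension `2 ^ n` and of `𝔠` in `2 ^ r`
    let 𝔠 : Submodule ℤ ℂ := interIntegers I ℚ⟮η⟯
    let Λ := coeffLattice hζ (idealModule I)
    let Λ' := coeffLattice hη 𝔠
    -- `I` is the direct sum of the `ζ ^ k 𝔠`
    ((⨆ k : Fin (2 ^ (n - r)), mulPow ζ k 𝔠) = idealModule I ∧
      iSupIndep (fun k : Fin (2 ^ (n - r)) => mulPow ζ k 𝔠)) ∧
    -- the summands are pairwise orthogonal under the coefficient embedding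
    (∀ k l : Fin (2 ^ (n - r)), k ≠ l →
      ∀ u ∈ coeffLattice hζ (mulPow ζ k 𝔠), ∀ v ∈ coeffLattice hζ (mulPow ζ l 𝔠),
        inner ℝ u v = 0) ∧
    -- the lattice of `𝔠` is a full-rank lattice of dimension `2 ^ r`
    (∃ b : Module.Basis (Fin (2 ^ r)) ℝ (EuclideanSpace ℝ (Fin (2 ^ r))),
      Λ' = Submodule.span ℤ (Set.range b)) ∧
    -- the first minima agree
    firstMin Λ = firstMin Λ' ∧
    -- each shortest vector of `𝔠` yields `2 ^ (n - r)` shortest vectors of `I`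
    (∀ x : ℚ⟮η⟯, IsShortest Λ' (coeffEmbedding hη x) →
      ∃ y : Fin (2 ^ (n - r)) → ℚ⟮ζ⟯, Function.Injective y ∧
        ∀ k, (y k : ℂ) = ζ ^ (k : ℕ) * (x : ℂ) ∧ IsShortest Λ (coeffEmbedding hζ (y k))) ∧
    -- one call to an SVP oracle in dimension `2 ^ r` solves SVP in `I`
    (∀ B : Matrix (Fin (2 ^ n)) (Fin (2 ^ n)) ℤ,
      (∀ i j, i < j → B i j = 0) → rowLattice B = Λ →
      let B' := B.submatrix (spreadIndex n r) (spreadIndex n r)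
      B'.det ≠ 0 ∧ rowLattice B' = Λ' ∧
        ∀ solve : Matrix (Fin (2 ^ r)) (Fin (2 ^ r)) ℤ → (Fin (2 ^ r) → ℤ),
          IsSVPOracle solve → IsShortest Λ (intVec (zeroPad n r (solve B')))) := by
  intro η hη 𝔠 Λ Λ'
  have h : r ≤ n := hr.le.trans (maxExp_le n p A)
  have hgen : GeneratedAt I (n - r) := by
    rw [hI]
    refine GeneratedAt.prod fun i =>
      GeneratedAt.of_isPrime hζ (hP i) (hp i) (hpP i) (hm i) (hA1 i) (hA3 i) ?_
    have : primeExp n (p i) (A i) ≤ maxExp n p A :=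
      Finset.le_sup (f := fun i => primeExp n (p i) (A i)) (Finset.mem_univ i)
    omega
  have hsum : (⨆ k : Fin (2 ^ (n - r)), mulPow ζ k 𝔠) = idealModule I := by
    have := iSup_mulPow_eq_idealModule hgen
    rwa [← interIntegers_eq hη] at this
  have h𝔠 : ∀ x ∈ 𝔠, x ∈ ℚ⟮η⟯ := fun x hx => mem_field_of_mem_interIntegers hx
  have H : ∀ v, v ∈ Λ ↔ ∀ k, component h k v ∈ Λ' := by
    have := mem_coeffLattice_iSup_mulPow hζ h hη h𝔠
    rwa [hsum] at this
  -- The integer `d = ∏ p i` puts `d` times every unit vector into both lattices, which gives full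
  -- rank, `Λ' ≠ ⊥` and the nonvanishing determinants.
  obtain ⟨d, hd0, hd⟩ : ∃ d : ℕ, d ≠ 0 ∧ (d : IntAdjoin ζ) ∈ I := by
    refine ⟨∏ i, p i, Finset.prod_ne_zero_iff.2 fun i _ => (hp i).ne_zero, ?_⟩
    rw [hI, Nat.cast_prod]
    exact Ideal.prod_mem_prod fun i _ => hpP i
  have hd0' : (d : ℤ) ≠ 0 := by exact_mod_cast hd0
  have hΛ : ∀ i, ∃ c : ℤ, c ≠ 0 ∧ intVec (Pi.single i c) ∈ Λ := fun i =>
    ⟨d, hd0', intVec_single_mem hζ (fun i => mul_mem_idealModule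
      (pow_mem (Algebra.self_mem_adjoin_singleton ℤ ζ) i) (coe_mem_idealModule.2 hd)) i⟩
  have hΛ' : ∀ i, ∃ c : ℤ, c ≠ 0 ∧ intVec (Pi.single i c) ∈ Λ' := fun i =>
    ⟨d, hd0', intVec_single_mem hη (pow_mul_mem_interIntegers hη hd) i⟩
  have hint : ∀ v ∈ Λ', ∃ c, v = intVec c := by
    rintro _ ⟨x, hx, rfl⟩
    have hx' : (x : ℂ) ∈ 𝔠 := hx
    exact exists_coeffEmbedding_eq_intVec hη ((interIntegers_eq hη I).le hx').2
  refine ⟨⟨hsum, iSupIndep_mulPow hζ h h𝔠⟩,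
    fun k l hkl u hu v hv => inner_eq_zero_of_mem_mulPow hζ h h𝔠 hkl hu hv,
    exists_basis_of_intVec hint hΛ', firstMin_eq H ?_,
    fun x hx => exists_isShortest_pow_mul hζ h hη H hx, fun B htri hB => ?_⟩
  · intro hbot
    obtain ⟨c, hc, hmem⟩ := hΛ' 0
    rw [hbot, Submodule.mem_bot] at hmem
    exact hc (by simpa [intVec] using congrArg (· 0) hmem)
  · intro B'
    obtain ⟨hdet, hrow⟩ := rowLattice_submatrix H hΛ htri hB
    refine ⟨hdet, hrow, fun solve hsolve => ?_⟩
    rw [intVec_zeroPad h]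
    exact (hrow ▸ hsolve B' hdet : IsShortest Λ' _).spread H 0
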